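/- Let $n\in\mathbb N=\{1,2,3,\dots\}$ and let $|\cdot|$ be the Euclidean norm on $\mathbb R^n$. Consider $$y'=-Ay+G(y)+f(t)\qquad\text{in }\mathbb R^n,\tag{1}$$ where: (a) $A$ is a real $n\times n$ diagonalizable matrix all of whose eigenvalues are positive; (b) $G:\mathbb R^n\to\mathbb R^n$ is locally Lipschitz, and there are homogeneous polynomials $G_m:\mathbb R^n\to\mathbb R^n$ of degree $m$, $m\ge 2$, such that for every $N\ge2$ there is $\delta>0$ with $\big|G(y)-\sum_{m=2}^N G_m(y)\big|=O(|y|^{N+\delta})$ as $y\to0$; (c) $f$ is an $\mathbb R^n$-valued function, continuous on $[T_f,\infty)$ for some $T_f\ge0$. Let $(\mu_k)_{k\ge1}$ be a strictly increasing sequence of positive numbers with $\mu_k\to\infty$ whose set of values $\{\mu_k:k\in\mathbb N\}$ is closed under addition and under $x\mapsto x+1$. For $g$ defined for large $t$ with values in $\mathbb R^n$, natural numbers $J_k\ge 1$, polynomials $p_{k,j}:\mathbb R\to\mathbb R^n$ of one variable (with vector coefficients) and real numbers $\beta_{k,j}$ ($1\le j\le J_k$), write $$g(t)\sim\sum_{k=1}^\infty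 \frac1{t^{\mu_k}}\Big(\sum_{j=1}^{J_k}\frac{p_{k,j}(\ln\ln t)}{(\ln t)^{\beta_{k,j}}}\Big)$$ if for every $N\ge1$ there is $\nu>\mu_N$ such that $$\Big|g(t)-\sum_{k=1}^N \frac1{t^{\mu_k}}\sum_{j=1}^{J_k}\frac{p_{k,j}(\ln\ln t)}{(\ln t)^{\beta_{k,j}}}\Big|=O(t^{-\nu})\quad\text{as }t\to\infty .$$ Assume that $$f(t)\sim\sum_{k=1}^\infty \frac1{t^{\mu_k}}\Big(\sum_{j=1}^{n_k}\frac{p_{k,j}(\ln\ln t)}{(\ln t)^{\beta_{k,j}}}\Big)$$ with natural numbers $n_k\ge1$, exponents $\beta_{k,j}\ge0$ and polynomials $p_{k,j}:\mathbb R\to\mathbb R^n$ for $1\le j\le n_k$. Let $y$ be a $C^1$ solution of (1) on $(T_0,\infty)$ for some $T_0\ge0$, with $y(t)\to0$ as $t\to\infty$. Then there exist natural numbers $J_k\ge1$, polynomials $q_{k,j}:\mathbb R\to\mathbb R^n$ and numbers $\gamma_{k,j}\ge0$ ($k\in\mathbb N$, $1\le j\le J_k$) such that $$y(t)\sim\sum_{k=1}^\infty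 \frac1{t^{\mu_k}}\Big(\sum_{j=1}^{J_k}\frac{q_{k,j}(\ln\ln t)}{(\ln t)^{\gamma_{k,j}}}\Big).$$ -/

import Mathlib

open Filter Topology Asymptotics

noncomputable section

namespace DecayODE

/-- Euclidean space `ℝⁿ` with its Euclidean norm. -/
abbrev Vec (n : ℕ) : Type := EuclideanSpace ℝ (Fin n)

/-- `A` is diagonalizable (over `ℝ`) and all its eigenvalues are positive. -/
structure DiagPosEigen {n : ℕ} (A : Matrix (Fin n) (Fin n) ℝ) : Prop where
  diagonalizable : ∃ (S : Matrix (Fin n) (Fin n) ℝ) (Λ : Fin n → ℝ),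
    IsUnit S ∧ A = S⁻¹ * Matrix.diagonal Λ * S
  pos_of_eigenvalue : ∀ a : ℝ, Module.End.HasEigenvalue (Matrix.toLin' A) a → 0 < a

/-- `F : ℝⁿ → ℝⁿ` is a homogeneous polynomial map of degree `m`. -/
def IsHomogPolyMap {n : ℕ} (m : ℕ) (F : Vec n → Vec n) : Prop :=
  ∃ P : Fin n → MvPolynomial (Fin n) ℝ, (∀ i, (P i).IsHomogeneous m) ∧
    ∀ (y : Vec n) (i : Fin n), F y i = MvPolynomial.eval (fun j => y j) (P i)

/-- The nonlinearity `G` is locally Lipschitz and has an asymptotic expansion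
`G(y) ∼ ∑_{m ≥ 2} G_m(y)` as `y → 0`, with `G_m` homogeneous polynomials of degree `m`. -/
structure AdmissibleNonlinearity {n : ℕ} (G : Vec n → Vec n) : Prop where
  locallyLipschitz : LocallyLipschitz G
  expansion : ∃ Gm : ℕ → Vec n → Vec n, (∀ m, 2 ≤ m → IsHomogPolyMap m (Gm m)) ∧
    ∀ N : ℕ, 2 ≤ N → ∃ δ : ℝ, 0 < δ ∧
      (fun y : Vec n => G y - ∑ m ∈ Finset.Icc 2 N, Gm m y)
        =O[𝓝 0] (fun y : Vec n => ‖y‖ ^ ((N : ℝ) + δ))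

/-- `f` is continuous on some half line `[T, ∞)` with `T ≥ 0`. -/
def EventuallyContinuous {n : ℕ} (f : ℝ → Vec n) : Prop :=
  ∃ T : ℝ, 0 ≤ T ∧ ContinuousOn f (Set.Ici T)

/-- `y` is a `C¹` solution of `y' = -A y + G(y) + f(t)` on some `(T, ∞)`, `T ≥ 0`, and
`y(t) → 0` as `t → ∞`. -/
structure IsDecayingSolution {n : ℕ} (A : Matrix (Fin n) (Fin n) ℝ) (G : Vec n → Vec n)
    (f y : ℝ → Vec n) : Prop where
  solution : ∃ T : ℝ, 0 ≤ T ∧ ContDiffOn ℝ 1 y (Set.Ioi T) ∧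
    ∀ t : ℝ, T < t → HasDerivAt y (-(Matrix.toEuclideanLin A (y t)) + G (y t) + f t) t
  decay : Tendsto y atTop (𝓝 0)

/-- A set of reals preserves the addition. -/
def PreservesAddition (S : Set ℝ) : Prop := ∀ x ∈ S, ∀ y ∈ S, x + y ∈ S

/-- A set of reals preserves the unit increment. -/
def PreservesUnitIncrement (S : Set ℝ) : Prop := ∀ x ∈ S, x + 1 ∈ S

/-- A strictly increasing sequence of positive numbers that diverges (to infinity). -/
structure IsExponentSeq (μ : ℕ → ℝ) : Prop where
  pos : ∀ k, 0 < μ k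
  strictMono : StrictMono μ
  divergent : Tendsto μ atTop atTop

/-- `p : ℝ → X` is an `X`-valued polynomial of one variable. -/
def IsPoly {X : Type*} [AddCommGroup X] [Module ℝ X] (p : ℝ → X) : Prop :=
  ∃ (N : ℕ) (a : ℕ → X), ∀ t : ℝ, p t = ∑ i ∈ Finset.range (N + 1), t ^ i • a i

/-- The iterated logarithm `L_m`: `L_0(t) = t`, `L_{m+1}(t) = ln (L_m(t))`. It is only used for
large `t`. -/
def iterLog (m : ℕ) (t : ℝ) : ℝ := Real.log^[m] t

/-- `𝓛_{m,k}(t) = (L_{m+1}(t), …, L_{m+k}(t))`. -/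
def iterLogVec (m k : ℕ) (t : ℝ) : Fin k → ℝ := fun i => iterLog (m + 1 + i) t

/-- The class `𝓟(k, X)` of finite sums `∑ c_α z^α` of vectors times real power monomials on
`(0, ∞)^k`. Functions are defined on all of `ℝ^k`; only the values on `(0, ∞)^k` matter. -/
def PowerClass (k : ℕ) (X : Type*) [AddCommGroup X] [Module ℝ X] :
    Set ((Fin k → ℝ) → X) :=
  {p | ∃ (I : Finset (Fin k → ℝ)) (c : (Fin k → ℝ) → X), I.Nonempty ∧
    ∀ z : Fin k → ℝ, (∀ i, 0 < z i) → p z = ∑ α ∈ I, (∏ i, z i ^ α i) • c α}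

/-- The asymptotic expansion
`g(t) ∼ ∑_k p_k(𝓛_{m,n_k}(t)) L_m(t)^{-γ_k}` as `t → ∞`. The index `k` starts at `0` here. -/
structure HasExpansion {X : Type*} [NormedAddCommGroup X] [NormedSpace ℝ X] (m : ℕ) (g : ℝ → X)
    (n : ℕ → ℕ) (p : (k : ℕ) → (Fin (n k) → ℝ) → X) (γ : ℕ → ℝ) : Prop where
  exponents : IsExponentSeq γ
  one_le : ∀ k, 1 ≤ n k
  mem_class : ∀ k, p k ∈ PowerClass (n k) X
  remainder : ∀ N : ℕ, ∃ ν : ℝ, γ N < ν ∧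
    (fun t : ℝ => g t - ∑ k ∈ Finset.range (N + 1),
        iterLog m t ^ (-γ k) • p k (iterLogVec m (n k) t))
      =O[atTop] (fun t : ℝ => iterLog m t ^ (-ν))

/-- The function `(z₁, z₂) ↦ ∑_{j < J} p_j(z₂) / z₁^{β_j}`. -/
def logCoeff {X : Type*} [AddCommGroup X] [Module ℝ X] (J : ℕ) (p : ℕ → ℝ → X) (β : ℕ → ℝ) :
    (Fin 2 → ℝ) → X :=
  fun z => ∑ j ∈ Finset.range J, (z 0 ^ (-β j)) • p j (z 1)

/-- The asymptotic expansion
`g(t) ∼ ∑_k t^{-μ_k} (∑_{j < J_k} p_{k,j}(ln ln t) / (ln t)^{β_{k,j}})`. -/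
def HasPowerLogLogLogExpansion {X : Type*} [NormedAddCommGroup X] [NormedSpace ℝ X]
    (g : ℝ → X) (μ : ℕ → ℝ) (J : ℕ → ℕ) (p : ℕ → ℕ → ℝ → X) (β : ℕ → ℕ → ℝ) : Prop :=
  HasExpansion 0 g (fun _ => 2) (fun k => logCoeff (J k) (p k) (β k)) μ

/-- If the `p_j` are polynomials, then `logCoeff` belongs to the class `𝓟(2, X)`. -/
theorem logCoeff_mem {X : Type*} [AddCommGroup X] [Module ℝ X] (J : ℕ) (p : ℕ → ℝ → X)
    (β : ℕ → ℝ) (hp : ∀ j < J, IsPoly (p j)) : logCoeff J p β ∈ PowerClass 2 X := by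
  classical
  have hp' : ∀ j, ∃ (N : ℕ) (a : ℕ → X), j < J → ∀ t : ℝ,
      p j t = ∑ i ∈ Finset.range (N + 1), t ^ i • a i := by
    intro j
    by_cases hj : j < J
    · obtain ⟨N, a, h⟩ := hp j hj
      exact ⟨N, a, fun _ => h⟩
    · exact ⟨0, 0, fun h => absurd h hj⟩
  choose N a h using hp'
  let s : Finset (Σ _ : ℕ, ℕ) := (Finset.range J).sigma (fun j => Finset.range (N j + 1))
  let e : (Σ _ : ℕ, ℕ) → (Fin 2 → ℝ) := fun x => ![-β x.1, (x.2 : ℝ)]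
  refine ⟨insert 0 (s.image e), fun α => ∑ x ∈ s with e x = α, a x.1 x.2,
    Finset.insert_nonempty _ _, fun z hz => ?_⟩
  have h1 : logCoeff J p β z = ∑ x ∈ s, (∏ i, z i ^ e x i) • a x.1 x.2 := by
    rw [Finset.sum_sigma]
    refine Finset.sum_congr rfl fun j hj => ?_
    rw [h j (Finset.mem_range.1 hj), Finset.smul_sum]
    refine Finset.sum_congr rfl fun i _ => ?_
    simp [e, smul_smul]
  rw [h1, ← Finset.sum_fiberwise_of_maps_to (g := e) (t := insert 0 (s.image e))
    (fun x hx => Finset.mem_insert_of_mem (Finset.mem_image_of_mem e hx))]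
  refine Finset.sum_congr rfl fun α _ => ?_
  rw [Finset.smul_sum]
  refine Finset.sum_congr rfl fun x hx => ?_
  rw [(Finset.mem_filter.1 hx).2]

/-- For polynomial `p_{k,j}` the expansion says, for every `N`, that
`g(t) - ∑_{k ≤ N} t^{-μ_k} ∑_j (ln t)^{-β_{k,j}} p_{k,j}(ln ln t) = O(t^{-ν})` for some
`ν > μ_N`. -/
theorem hasPowerLogLogLogExpansion_iff {X : Type*} [NormedAddCommGroup X] [NormedSpace ℝ X]
    (g : ℝ → X) (μ : ℕ → ℝ) (J : ℕ → ℕ) (p : ℕ → ℕ → ℝ → X) (β : ℕ → ℕ → ℝ)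
    (hμ : IsExponentSeq μ) (hp : ∀ k, ∀ j < J k, IsPoly (p k j)) :
    HasPowerLogLogLogExpansion g μ J p β ↔
      ∀ N : ℕ, ∃ ν : ℝ, μ N < ν ∧
        (fun t : ℝ => g t - ∑ k ∈ Finset.range (N + 1), t ^ (-μ k) •
          ∑ j ∈ Finset.range (J k),
            (Real.log t ^ (-β k j)) • p k j (Real.log (Real.log t)))
          =O[atTop] (fun t : ℝ => t ^ (-ν)) :=
  ⟨fun h => h.remainder, fun h =>
    ⟨hμ, fun _ => one_le_two, fun k => logCoeff_mem _ _ _ (hp k), h⟩⟩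

end DecayODE

end

noncomputable section

namespace DecayODE

/-! ### Homogeneous polynomials along filtrations of a commutative algebra. -/

section Polynomial

variable {R : Type*} [CommRing R] [Algebra ℝ R] {n : ℕ}

/-! Insert a formal series `∑ a_k`, with `a_k` of size `t ^ (-μ k)` up to powers of `log t` and `log
(log t)`, into the equation. Differentiation gains a factor `1 / t`, and a product of two decaying
terms decays faster than either factor. As the exponents are closed under `+ 1` and addition, both
operations only produce terms of strictly larger index. At order `N` what remains is the algebraic
equation `A a_N = F_N + (terms fixed by a_0, …, a_{N-1})`, solvable because `A` is invertible
(`exists_next`, `exists_formal_solution`). No free constants appear: solutions of the homogeneous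
linear equation decay exponentially.

To show that `y` follows the series, let `z` be `y` minus a partial sum. Then `z' = -A z + g`, where
`g` consists of the residual, truncation errors, and differences of polynomials of degree at least
two, which are smaller than `z` by a factor `t ^ (-c)`. Since `-A` is stable, `z` inherits the decay
of `g` (`isBigO_of_perturbation`). Finitely many iterations, each gaining `t ^ (-c)`, reach the
order of the residual (`IsDecayingSolution.isBigO_sub`).

Both halves, and the estimate of `G` near `0`, use the same algebra: `aeval_sub_mem` is applied to
the index filtration, to decay rates and to orders of vanishing. -/

theorem aeval_mem_of_monomials {m : ℕ} (W : Submodule ℝ R) (u : Fin n → R)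
    (h : ∀ s : Fin n →₀ ℕ, s.degree = m → (s.prod fun i k => u i ^ k) ∈ W)
    {P : MvPolynomial (Fin n) ℝ} (hP : P.IsHomogeneous m) : MvPolynomial.aeval u P ∈ W := by
  rw [MvPolynomial.aeval_def, MvPolynomial.eval₂_eq]
  refine Submodule.sum_mem _ fun s hs => ?_
  rw [← Algebra.smul_def]
  refine W.smul_mem _ ?_
  have := h s (by
    have := hP (MvPolynomial.mem_support_iff.1 hs)
    exact (DFunLike.congr_fun Finsupp.degree_eq_weight_one s).trans this)
  exact this

theorem exists_eq_add_single {m : ℕ} {s : Fin n →₀ ℕ} (hs : s.degree = m + 1) :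
    ∃ (i : Fin n) (s' : Fin n →₀ ℕ), s'.degree = m ∧ s = s' + Finsupp.single i 1 := by
  have : s ≠ 0 := by rintro rfl; simp at hs
  obtain ⟨i, hi⟩ := Finsupp.ne_iff.1 this
  have h : s = (s - Finsupp.single i 1) + Finsupp.single i 1 := by
    ext j
    by_cases hj : j = i
    · subst hj
      simp at hi ⊢
      omega
    · simp [Ne.symm hj]
  refine ⟨i, _, ?_, h⟩
  have h2 := congrArg Finsupp.degree h
  rw [map_add, hs, Finsupp.degree_single] at h2
  omega

theorem prod_add_single {R : Type*} [CommRing R] {n : ℕ} (u : Fin n → R) (s : Fin n →₀ ℕ) (i : Fin n) :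
    ((s + Finsupp.single i 1).prod fun i k => u i ^ k) = u i * s.prod fun i k => u i ^ k := by
  rw [Finsupp.prod_add_index' (by simp) (by intros; rw [pow_add]), mul_comm]
  simp

/-- Peel off one variable at a time. The induction starts at degree one because the constant `1`
need not lie in any layer. -/
theorem monomial_mem {I : Submodule ℝ R} {W : ℕ → Submodule ℝ R}
    (hW : ∀ m, 1 ≤ m → ∀ a ∈ I, ∀ b ∈ W m, a * b ∈ W (m + 1)) {u : Fin n → R}
    (hu : ∀ i, u i ∈ I) (hu' : ∀ i, u i ∈ W 1) {m : ℕ} (hm : 1 ≤ m) :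
    ∀ s : Fin n →₀ ℕ, s.degree = m → (s.prod fun i k => u i ^ k) ∈ W m := by
  induction m, hm using Nat.le_induction with
  | base =>
    intro s hs
    obtain ⟨i, s', hs', rfl⟩ := exists_eq_add_single (m := 0) hs
    rw [Finsupp.degree_eq_zero_iff] at hs'
    subst hs'
    rw [prod_add_single]
    simpa using hu' i
  | succ m hm ih =>
    intro s hs
    obtain ⟨i, s', hs', rfl⟩ := exists_eq_add_single hs
    rw [prod_add_single]
    exact hW m hm _ (hu i) _ (ih s' hs')

/-- Values of homogeneous polynomials of degree `m` at points of the first layer of a filtration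
lie in its `m`-th layer. -/
theorem aeval_mem {I : Submodule ℝ R} {W : ℕ → Submodule ℝ R}
    (hW : ∀ m, 1 ≤ m → ∀ a ∈ I, ∀ b ∈ W m, a * b ∈ W (m + 1)) {u : Fin n → R}
    (hu : ∀ i, u i ∈ I) (hu' : ∀ i, u i ∈ W 1) {m : ℕ} (hm : 1 ≤ m)
    {P : MvPolynomial (Fin n) ℝ} (hP : P.IsHomogeneous m) : MvPolynomial.aeval u P ∈ W m :=
  aeval_mem_of_monomials _ _ (monomial_mem hW hu hu' hm) hP

/-- Induction on the degree through `u u' - v v' = u (u' - v') + v' (u - v)`. Degree one only gives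
`J`; from degree two on there is a spare factor from `I`, which improves `J` to `J'`. -/
theorem monomial_sub_mem {I J J' : Submodule ℝ R} (hII : ∀ a ∈ I, ∀ b ∈ I, a * b ∈ I)
    (hIJ : ∀ a ∈ I, ∀ b ∈ J, a * b ∈ J') (hJ : J' ≤ J) {u v : Fin n → R}
    (hu : ∀ i, u i ∈ I) (hv : ∀ i, v i ∈ I) (huv : ∀ i, u i - v i ∈ J) {m : ℕ} (hm : 1 ≤ m) :
    ∀ s : Fin n →₀ ℕ, s.degree = m →
      ((s.prod fun i k => u i ^ k) - s.prod fun i k => v i ^ k) ∈ J ∧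
      (2 ≤ m → ((s.prod fun i k => u i ^ k) - s.prod fun i k => v i ^ k) ∈ J') := by
  induction m, hm using Nat.le_induction with
  | base =>
    intro s hs
    obtain ⟨i, s', hs', rfl⟩ := exists_eq_add_single (m := 0) hs
    rw [Finsupp.degree_eq_zero_iff] at hs'
    subst hs'
    rw [prod_add_single, prod_add_single]
    refine ⟨by simpa using huv i, by omega⟩
  | succ m hm ih =>
    intro s hs
    obtain ⟨i, s', hs', rfl⟩ := exists_eq_add_single hs
    have hv' : (s'.prod fun i k => v i ^ k) ∈ I :=
      monomial_mem (W := fun _ => I) (fun _ _ => hII) hv hv hm s' hs'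
    have key : ((s' + Finsupp.single i 1).prod fun i k => u i ^ k) -
        ((s' + Finsupp.single i 1).prod fun i k => v i ^ k) ∈ J' := by
      rw [prod_add_single, prod_add_single]
      have : u i * (s'.prod fun i k => u i ^ k) - v i * (s'.prod fun i k => v i ^ k) =
          u i * ((s'.prod fun i k => u i ^ k) - s'.prod fun i k => v i ^ k) +
          (s'.prod fun i k => v i ^ k) * (u i - v i) := by ring
      rw [this]
      exact J'.add_mem (hIJ _ (hu i) _ (ih s' hs').1) (hIJ _ hv' _ (huv i))
    exact ⟨hJ key, fun _ => key⟩

/-- The difference of the values of a homogeneous polynomial of degree at least two at nearby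
points is of higher order than the difference of the points. -/
theorem aeval_sub_mem {I J J' : Submodule ℝ R} (hII : ∀ a ∈ I, ∀ b ∈ I, a * b ∈ I)
    (hIJ : ∀ a ∈ I, ∀ b ∈ J, a * b ∈ J') (hJ : J' ≤ J) {u v : Fin n → R}
    (hu : ∀ i, u i ∈ I) (hv : ∀ i, v i ∈ I) (huv : ∀ i, u i - v i ∈ J) {m : ℕ} (hm : 2 ≤ m)
    {P : MvPolynomial (Fin n) ℝ} (hP : P.IsHomogeneous m) :
    MvPolynomial.aeval u P - MvPolynomial.aeval v P ∈ J' := by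
  simp only [MvPolynomial.aeval_def, MvPolynomial.eval₂_eq]
  rw [← Finset.sum_sub_distrib]
  refine Submodule.sum_mem _ fun s hs => ?_
  rw [← mul_sub, ← Algebra.smul_def]
  refine J'.smul_mem _ ?_
  have := (monomial_sub_mem hII hIJ hJ hu hv huv (by omega) s (by
    have := hP (MvPolynomial.mem_support_iff.1 hs)
    exact (DFunLike.congr_fun Finsupp.degree_eq_weight_one s).trans this)).2 hm
  simpa only [Finsupp.prod] using this

end Polynomial

theorem aeval_apply {α : Type*} {n : ℕ} (u : Fin n → α → ℝ) (P : MvPolynomial (Fin n) ℝ) (t : α) :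
    MvPolynomial.aeval u P t = MvPolynomial.eval (fun j => u j t) P := by
  have := MvPolynomial.map_aeval u (Pi.evalRingHom (fun _ : α => ℝ) t) P
  simp only [Pi.evalRingHom_apply] at this
  rw [this, MvPolynomial.eval, MvPolynomial.coe_eval₂Hom]
  rfl

/-! ### Calculus of the log monomials. -/

/-- The function `t ^ (-a) * (log t) ^ (-b) * (log (log t)) ^ j`, in a form that is multiplicative
in the exponents for all `t`. -/
def logMono (a b : ℝ) (j : ℕ) : ℝ → ℝ := fun t =>
  Real.exp (-a * Real.log t - b * Real.log (Real.log t)) * Real.log (Real.log t) ^ j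

theorem logMono_mul (a b a' b' : ℝ) (j j' : ℕ) :
    logMono a b j * logMono a' b' j' = logMono (a + a') (b + b') (j + j') := by
  ext t
  simp only [logMono, Pi.mul_apply]
  rw [pow_add, show -(a + a') * Real.log t - (b + b') * Real.log (Real.log t) =
    (-a * Real.log t - b * Real.log (Real.log t)) +
    (-a' * Real.log t - b' * Real.log (Real.log t)) by ring, Real.exp_add]
  ring

theorem logMono_eq (a b : ℝ) (j : ℕ) {t : ℝ} (ht : 1 < t) :
    logMono a b j t = t ^ (-a) * (Real.log t ^ (-b) * Real.log (Real.log t) ^ j) := by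
  have h1 : 0 < Real.log t := Real.log_pos ht
  rw [logMono, Real.rpow_def_of_pos (by linarith), Real.rpow_def_of_pos h1, ← mul_assoc,
    ← Real.exp_add]
  congr 2
  ring

/-- Every term gains a factor `1 / t` and no exponent of `1 / log t` drops, so `b ≥ 0` persists. For
`j = 0` the truncated `j - 1` is harmless, its coefficient being zero. -/
theorem hasDerivAt_logMono (a b : ℝ) (j : ℕ) {t : ℝ} (ht : 1 < t) :
    HasDerivAt (logMono a b j) ((-a • logMono (a + 1) b j + -b • logMono (a + 1) (b + 1) j +
      (j : ℝ) • logMono (a + 1) (b + 1) (j - 1)) t) t := by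
  have h1 : 0 < Real.log t := Real.log_pos ht
  have h0 : 0 < t := by linarith
  have hl := Real.hasDerivAt_log h0.ne'
  have hll := hl.log h1.ne'
  have := (((hl.const_mul (-a)).sub (hll.const_mul b)).exp).mul (hll.pow j)
  refine this.congr_deriv ?_
  have e1 : Real.exp (-(a + 1) * Real.log t - b * Real.log (Real.log t)) =
      Real.exp (-a * Real.log t - b * Real.log (Real.log t)) * t⁻¹ := by
    rw [show -(a + 1) * Real.log t - b * Real.log (Real.log t) =
      (-a * Real.log t - b * Real.log (Real.log t)) + -Real.log t by ring, Real.exp_add,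
      Real.exp_neg, Real.exp_log h0]
  have e2 : Real.exp (-(a + 1) * Real.log t - (b + 1) * Real.log (Real.log t)) =
      Real.exp (-a * Real.log t - b * Real.log (Real.log t)) * t⁻¹ * (Real.log t)⁻¹ := by
    rw [show -(a + 1) * Real.log t - (b + 1) * Real.log (Real.log t) =
      (-(a + 1) * Real.log t - b * Real.log (Real.log t)) + -Real.log (Real.log t) by ring,
      Real.exp_add, e1, Real.exp_neg, Real.exp_log h1]
  simp only [logMono, Pi.add_apply, Pi.smul_apply, smul_eq_mul, e1, e2, Pi.sub_apply, Pi.pow_apply]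
  field_simp
  ring

/-- The spare power `t ^ (a - ν)` absorbs `(log (log t)) ^ j ≤ (log t) ^ j`. The inequality `ν < a`
is strict since the factor `(log (log t)) ^ j` may be unbounded. -/
theorem isBigO_logMono {a b ν : ℝ} (hb : 0 ≤ b) (j : ℕ) (hν : ν < a) :
    logMono a b j =O[atTop] fun t : ℝ => t ^ (-ν) := by
  have h1 : (fun t => Real.log t ^ (j : ℝ)) =o[atTop] fun t : ℝ => t ^ (a - ν) :=
    isLittleO_log_rpow_rpow_atTop _ (by linarith)
  have h2 : (fun t : ℝ => t ^ (-a) * Real.log t ^ (j : ℝ)) =O[atTop]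
      fun t : ℝ => t ^ (-a) * t ^ (a - ν) := (isBigO_refl _ _).mul h1.isBigO
  have h3 : (fun t : ℝ => t ^ (-a) * t ^ (a - ν)) =ᶠ[atTop] fun t : ℝ => t ^ (-ν) := by
    filter_upwards [eventually_gt_atTop 0] with t ht
    rw [← Real.rpow_add ht]
    congr 1
    ring
  refine IsBigO.trans ?_ (h2.trans_eventuallyEq h3)
  refine IsBigO.of_bound 1 ?_
  filter_upwards [eventually_ge_atTop (Real.exp 1)] with t ht
  have hlog : 1 ≤ Real.log t := by
    rw [Real.le_log_iff_exp_le (lt_of_lt_of_le (Real.exp_pos 1) ht)]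
    exact ht
  have ht1 : 1 < t := by
    by_contra h
    have := Real.exp_one_gt_d9
    linarith
  have ht0 : (0 : ℝ) ≤ t ^ (-a) := Real.rpow_nonneg (by linarith) _
  have hll : 0 ≤ Real.log (Real.log t) := Real.log_nonneg hlog
  rw [logMono_eq _ _ _ ht1, one_mul, norm_mul, norm_mul _ (_ ^ (j : ℝ)), Real.rpow_natCast]
  refine mul_le_mul_of_nonneg_left ?_ (norm_nonneg _)
  rw [norm_mul, norm_pow, norm_pow, Real.norm_of_nonneg hll, Real.norm_of_nonneg (by linarith :
    0 ≤ Real.log t), Real.norm_of_nonneg (Real.rpow_nonneg (by linarith) _)]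
  have hb1 : Real.log t ^ (-b) ≤ 1 := Real.rpow_le_one_of_one_le_of_nonpos hlog (by linarith)
  have hle : Real.log (Real.log t) ≤ Real.log t := by
    have := Real.log_le_sub_one_of_pos (show 0 < Real.log t by linarith)
    linarith
  calc _ ≤ 1 * Real.log t ^ j := by gcongr
    _ = _ := one_mul _

/-! ### Layers and tails: the index filtration of log expansions. -/

section Layers

variable (μ : ℕ → ℝ)

/-- The span of the functions `t ^ (-μ k) * (log t) ^ (-b) * (log (log t)) ^ j` with `b ≥ 0`. -/
def layer (k : ℕ) : Submodule ℝ (ℝ → ℝ) :=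
  Submodule.span ℝ {g | ∃ (b : ℝ) (j : ℕ), 0 ≤ b ∧ g = logMono (μ k) b j}

/-- The sum of all layers from the `N`-th one on. -/
def tail (N : ℕ) : Submodule ℝ (ℝ → ℝ) :=
  Submodule.span ℝ {g | ∃ (k : ℕ) (b : ℝ) (j : ℕ), N ≤ k ∧ 0 ≤ b ∧ g = logMono (μ k) b j}

variable {μ}

theorem tail_anti {M N : ℕ} (h : M ≤ N) : tail μ N ≤ tail μ M :=
  Submodule.span_mono fun _ ⟨k, b, j, hk, hb, e⟩ => ⟨k, b, j, h.trans hk, hb, e⟩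

theorem layer_le_tail {k N : ℕ} (h : N ≤ k) : layer μ k ≤ tail μ N :=
  Submodule.span_mono fun _ ⟨b, j, hb, e⟩ => ⟨k, b, j, h, hb, e⟩

theorem logMono_mem_layer (k : ℕ) {b : ℝ} (hb : 0 ≤ b) (j : ℕ) : logMono (μ k) b j ∈ layer μ k :=
  Submodule.subset_span ⟨b, j, hb, rfl⟩

theorem logMono_mem_tail {k N : ℕ} (h : N ≤ k) {b : ℝ} (hb : 0 ≤ b) (j : ℕ) :
    logMono (μ k) b j ∈ tail μ N :=
  layer_le_tail h (logMono_mem_layer k hb j)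

/-- If `μ k + μ k' = μ l`, then `l > k'` because `μ k > 0`. Only the gain of one index over the
second factor is needed. -/
theorem mul_mem_tail (hμ : IsExponentSeq μ) (hadd : PreservesAddition (Set.range μ)) {M N : ℕ}
    {g h : ℝ → ℝ} (hg : g ∈ tail μ M) (hh : h ∈ tail μ N) : g * h ∈ tail μ (N + 1) := by
  have : tail μ M * tail μ N ≤ tail μ (N + 1) := by
    rw [tail, tail, Submodule.span_mul_span, Submodule.span_le]
    rintro _ ⟨_, ⟨k, b, j, hk, hb, rfl⟩, _, ⟨k', b', j', hk', hb', rfl⟩, rfl⟩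
    obtain ⟨l, hl⟩ := hadd _ ⟨k, rfl⟩ _ ⟨k', rfl⟩
    have : k' < l := hμ.strictMono.lt_iff_lt.1 (by rw [hl]; linarith [hμ.pos k])
    simp only [logMono_mul, ← hl]
    exact logMono_mem_tail (by omega) (add_nonneg hb hb') _
  exact this (Submodule.mul_mem_mul hg hh)

theorem exists_hasDerivAt_of_mem_layer (hμ : IsExponentSeq μ)
    (hunit : PreservesUnitIncrement (Set.range μ)) {k : ℕ} {g : ℝ → ℝ} (hg : g ∈ layer μ k) :
    ∃ g' ∈ tail μ (k + 1), ∀ t : ℝ, 1 < t → HasDerivAt g (g' t) t := by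
  induction hg using Submodule.span_induction with
  | mem g hg =>
    obtain ⟨b, j, hb, rfl⟩ := hg
    obtain ⟨l, hl⟩ := hunit _ ⟨k, rfl⟩
    have : k < l := hμ.strictMono.lt_iff_lt.1 (by rw [hl]; linarith)
    refine ⟨_, ?_, fun t ht => hasDerivAt_logMono (μ k) b j ht⟩
    rw [← hl]
    refine add_mem (add_mem ?_ ?_) ?_ <;> refine Submodule.smul_mem _ _ ?_
    · exact logMono_mem_tail (by omega) hb _
    · exact logMono_mem_tail (by omega) (by linarith) _
    · exact logMono_mem_tail (by omega) (by linarith) _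
  | zero => exact ⟨0, zero_mem _, fun t _ => hasDerivAt_const t 0⟩
  | add g h _ _ hg hh =>
    obtain ⟨g', hg', hg⟩ := hg
    obtain ⟨h', hh', hh⟩ := hh
    exact ⟨_, add_mem hg' hh', fun t ht => (hg t ht).add (hh t ht)⟩
  | smul c g _ hg =>
    obtain ⟨g', hg', hg⟩ := hg
    exact ⟨_, Submodule.smul_mem _ c hg', fun t ht => (hg t ht).const_smul c⟩

theorem exists_head {N : ℕ} {g : ℝ → ℝ} (hg : g ∈ tail μ N) :
    ∃ h ∈ layer μ N, g - h ∈ tail μ (N + 1) := by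
  induction hg using Submodule.span_induction with
  | mem g hg =>
    obtain ⟨k, b, j, hk, hb, rfl⟩ := hg
    rcases hk.eq_or_lt with rfl | hk
    · exact ⟨_, logMono_mem_layer _ hb j, by simp⟩
    · exact ⟨0, zero_mem _, by simpa using logMono_mem_tail hk hb j⟩
  | zero => exact ⟨0, zero_mem _, by simp⟩
  | add g h _ _ hg hh =>
    obtain ⟨g', hg', hg⟩ := hg
    obtain ⟨h', hh', hh⟩ := hh
    refine ⟨_, add_mem hg' hh', ?_⟩
    rw [add_sub_add_comm]
    exact add_mem hg hh
  | smul c g _ hg =>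
    obtain ⟨g', hg', hg⟩ := hg
    refine ⟨_, Submodule.smul_mem _ c hg', ?_⟩
    rw [← smul_sub]
    exact Submodule.smul_mem _ c hg

theorem isBigO_of_mem_tail (hμ : IsExponentSeq μ) {N : ℕ} {ν : ℝ} (hν : ν < μ N) {g : ℝ → ℝ}
    (hg : g ∈ tail μ N) : g =O[atTop] fun t : ℝ => t ^ (-ν) := by
  induction hg using Submodule.span_induction with
  | mem g hg =>
    obtain ⟨k, b, j, hk, hb, rfl⟩ := hg
    exact isBigO_logMono hb j (hν.trans_le (hμ.strictMono.monotone hk))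
  | zero => exact isBigO_zero _ _
  | add g h _ _ hg hh => exact hg.add hh
  | smul c g _ hg => exact hg.const_smul_left c

end Layers

/-! ### Construction of the formal solution. -/

section Formal

variable {μ : ℕ → ℝ} {n : ℕ}

/-- The left-over of the equation when the approximate solution `Y`, with derivative `Y'`, is
inserted into it and `G` and `f` are truncated. -/
def residual (A : Matrix (Fin n) (Fin n) ℝ) (P : ℕ → Fin n → MvPolynomial (Fin n) ℝ)
    (F : ℕ → Fin n → ℝ → ℝ) (M N : ℕ) (Y Y' : Fin n → ℝ → ℝ) (i : Fin n) : ℝ → ℝ :=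
  -(∑ j, A i j • Y j) - Y' i + ∑ m ∈ Finset.Icc 2 M, MvPolynomial.aeval Y (P m i) +
    ∑ k ∈ Finset.range N, F k i

/-- A layer is a vector space, so the constant matrix `A⁻¹` acts on tuples of its elements. -/
theorem exists_solve_layer {A : Matrix (Fin n) (Fin n) ℝ} (hA : IsUnit A) (N : ℕ)
    {h : Fin n → ℝ → ℝ} (hh : ∀ i, h i ∈ layer μ N) :
    ∃ a : Fin n → ℝ → ℝ, (∀ i, a i ∈ layer μ N) ∧ ∀ i, ∑ j, A i j • a j = h i := by
  refine ⟨fun i => ∑ j, A⁻¹ i j • h j, fun i => Submodule.sum_mem _ fun j _ =>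
    Submodule.smul_mem _ _ (hh j), fun i => ?_⟩
  have h1 : A * A⁻¹ = 1 := Matrix.mul_nonsing_inv A ((Matrix.isUnit_iff_isUnit_det A).1 hA)
  simp only [Finset.smul_sum, smul_smul]
  rw [Finset.sum_comm]
  simp only [← Finset.sum_smul, ← Matrix.mul_apply, h1, Matrix.one_apply, ite_smul, one_smul,
    zero_smul, Finset.sum_ite_eq, Finset.mem_univ, if_true]

theorem aeval_mem_tail (hμ : IsExponentSeq μ) (hadd : PreservesAddition (Set.range μ))
    {Y : Fin n → ℝ → ℝ} (hY : ∀ i, Y i ∈ tail μ 0) {m : ℕ} (hm : 1 ≤ m)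
    {P : MvPolynomial (Fin n) ℝ} (hP : P.IsHomogeneous m) :
    MvPolynomial.aeval Y P ∈ tail μ (m - 1) := by
  refine aeval_mem (I := tail μ 0) (W := fun m => tail μ (m - 1)) ?_ hY hY hm hP
  intro m hm a ha b hb
  have := mul_mem_tail hμ hadd ha hb
  rwa [Nat.sub_add_cancel hm] at this

/-- Terms of degree above `N + 1` already lie in the `N`-th tail, so the truncation degree of `G`
may be raised freely. -/
theorem residual_mem_tail_of_le (hμ : IsExponentSeq μ) (hadd : PreservesAddition (Set.range μ))
    {A : Matrix (Fin n) (Fin n) ℝ} {P : ℕ → Fin n → MvPolynomial (Fin n) ℝ}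
    (hP : ∀ m, 2 ≤ m → ∀ i, (P m i).IsHomogeneous m)
    {F : ℕ → Fin n → ℝ → ℝ} {N : ℕ} {Y Y' : Fin n → ℝ → ℝ} (hY : ∀ i, Y i ∈ tail μ 0) (i : Fin n)
    (h : residual A P F (N + 1) N Y Y' i ∈ tail μ N) {M : ℕ} (hM : N + 1 ≤ M) :
    residual A P F M N Y Y' i ∈ tail μ N := by
  induction M, hM using Nat.le_induction with
  | base => exact h
  | succ M hM ih =>
    have : residual A P F (M + 1) N Y Y' i =
        residual A P F M N Y Y' i + MvPolynomial.aeval Y (P (M + 1) i) := by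
      rw [residual, residual, Finset.sum_Icc_succ_top (by omega)]
      abel
    rw [this]
    exact add_mem ih (tail_anti (by omega)
      (aeval_mem_tail hμ hadd hY (by omega) (hP (M + 1) (by omega) i)))

/-- One more term of the formal solution. -/
theorem exists_next (hμ : IsExponentSeq μ) (hadd : PreservesAddition (Set.range μ))
    (hunit : PreservesUnitIncrement (Set.range μ))
    {A : Matrix (Fin n) (Fin n) ℝ} (hA : IsUnit A) {P : ℕ → Fin n → MvPolynomial (Fin n) ℝ}
    (hP : ∀ m, 2 ≤ m → ∀ i, (P m i).IsHomogeneous m)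
    {F : ℕ → Fin n → ℝ → ℝ} (hF : ∀ k i, F k i ∈ layer μ k) {N : ℕ} {Y Y' : Fin n → ℝ → ℝ}
    (hY : ∀ i, Y i ∈ tail μ 0) (hres : ∀ i, residual A P F (N + 1) N Y Y' i ∈ tail μ N) :
    ∃ a a' : Fin n → ℝ → ℝ, (∀ i, a i ∈ layer μ N) ∧
      (∀ i, ∀ t : ℝ, 1 < t → HasDerivAt (a i) (a' i t) t) ∧
      ∀ i, residual A P F (N + 1 + 1) (N + 1) (Y + a) (Y' + a') i ∈ tail μ (N + 1) := by
  -- The new term solves `A a = h + F N`, with `h` the leading layer of the old residual: this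
  -- cancels everything in layer `N`.
  choose h hh hh' using fun i => exists_head (hres i)
  obtain ⟨a, ha, hAa⟩ := exists_solve_layer hA N (fun i => add_mem (hh i) (hF N i))
  choose a' ha' hd using fun i => exists_hasDerivAt_of_mem_layer hμ hunit (ha i)
  have ha0 : ∀ i, a i ∈ tail μ 0 := fun i => layer_le_tail (Nat.zero_le _) (ha i)
  have hYa : ∀ i, (Y + a) i ∈ tail μ 0 := fun i => add_mem (hY i) (ha0 i)
  refine ⟨a, a', ha, hd, fun i => ?_⟩
  -- After the cancellation each group lies in the next tail: the rest of the old residual, the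
  -- derivative of `a`, the change in the polynomials already present, and the newly admitted
  -- degree.
  have key : residual A P F (N + 1 + 1) (N + 1) (Y + a) (Y' + a') i =
      (residual A P F (N + 1) N Y Y' i - h i) - a' i +
      ∑ m ∈ Finset.Icc 2 (N + 1),
        (MvPolynomial.aeval (Y + a) (P m i) - MvPolynomial.aeval Y (P m i)) +
      MvPolynomial.aeval (Y + a) (P (N + 1 + 1) i) := by
    have e : ∑ j, A i j • (Y + a) j = ∑ j, A i j • Y j + (h i + F N i) := by
      rw [← hAa i, ← Finset.sum_add_distrib]
      simp [smul_add]
    rw [residual, residual, e, Finset.sum_Icc_succ_top (by omega), Finset.sum_range_succ,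
      Finset.sum_sub_distrib, Pi.add_apply]
    abel
  rw [key]
  refine add_mem (add_mem (sub_mem (hh' i) (ha' i)) (Submodule.sum_mem _ fun m hm => ?_)) ?_
  · have hm := (Finset.mem_Icc.1 hm).1
    refine aeval_sub_mem (I := tail μ 0) (J := tail μ N) ?_ ?_ (tail_anti (Nat.le_succ N)) hYa hY
      (fun i => ?_) hm (hP m hm i)
    · exact fun a ha b hb => tail_anti (Nat.zero_le _) (mul_mem_tail hμ hadd ha hb)
    · exact fun a ha b hb => mul_mem_tail hμ hadd ha hb
    · simpa using layer_le_tail le_rfl (ha i)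
  · have h1 := aeval_mem_tail hμ hadd hYa (by omega) (hP (N + 1 + 1) (by omega) i)
    rwa [Nat.add_sub_cancel] at h1

/-- The formal solution of the equation. -/
theorem exists_formal_solution (hμ : IsExponentSeq μ) (hadd : PreservesAddition (Set.range μ))
    (hunit : PreservesUnitIncrement (Set.range μ))
    {A : Matrix (Fin n) (Fin n) ℝ} (hA : IsUnit A) {P : ℕ → Fin n → MvPolynomial (Fin n) ℝ}
    (hP : ∀ m, 2 ≤ m → ∀ i, (P m i).IsHomogeneous m)
    {F : ℕ → Fin n → ℝ → ℝ} (hF : ∀ k i, F k i ∈ layer μ k) :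
    ∃ a : ℕ → Fin n → ℝ → ℝ, (∀ k i, a k i ∈ layer μ k) ∧ ∀ N, ∃ Y' : Fin n → ℝ → ℝ,
      (∀ i, ∀ t : ℝ, 1 < t → HasDerivAt (∑ k ∈ Finset.range N, a k i) (Y' i t) t) ∧
      ∀ M, N + 1 ≤ M → ∀ i,
        residual A P F M N (fun i => ∑ k ∈ Finset.range N, a k i) Y' i ∈ tail μ N := by
  let Inv : ℕ → (Fin n → ℝ → ℝ) × (Fin n → ℝ → ℝ) → Prop := fun N s =>
    (∀ i, s.1 i ∈ tail μ 0) ∧ (∀ i, ∀ t : ℝ, 1 < t → HasDerivAt (s.1 i) (s.2 i t) t) ∧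
      ∀ i, residual A P F (N + 1) N s.1 s.2 i ∈ tail μ N
  have step : ∀ N s, Inv N s → ∃ s', Inv (N + 1) s' ∧ ∀ i, s'.1 i - s.1 i ∈ layer μ N := by
    rintro N ⟨Y, Y'⟩ ⟨h1, h2, h3⟩
    obtain ⟨a, a', ha, hd, hr⟩ := exists_next hμ hadd hunit hA hP hF h1 h3
    refine ⟨(Y + a, Y' + a'), ⟨fun i => add_mem (h1 i) (layer_le_tail (Nat.zero_le _) (ha i)),
      fun i t ht => (h2 i t ht).add (hd i t ht), hr⟩, fun i => by simpa using ha i⟩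
  choose! next hnext using step
  let seq : ℕ → (Fin n → ℝ → ℝ) × (Fin n → ℝ → ℝ) := fun N => Nat.rec (0, 0) next N
  have hseq : ∀ N, Inv N (seq N) := by
    intro N
    induction N with
    | zero =>
      refine ⟨fun i => zero_mem _, fun i t _ => hasDerivAt_const t 0, fun i => ?_⟩
      have : residual A P F (0 + 1) 0 (seq 0).1 (seq 0).2 i = 0 := by
        simp [residual, seq]
      rw [this]
      exact zero_mem _
    | succ N ih => exact (hnext N _ ih).1
  have hsum : ∀ N i, ∑ k ∈ Finset.range N, ((seq (k + 1)).1 i - (seq k).1 i) = (seq N).1 i := by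
    intro N i
    rw [Finset.sum_range_sub (fun k => (seq k).1 i)]
    simp [seq]
  refine ⟨fun k i => (seq (k + 1)).1 i - (seq k).1 i, fun k i => (hnext k _ (hseq k)).2 i,
    fun N => ⟨(seq N).2, ?_⟩⟩
  simp only [hsum]
  exact ⟨(hseq N).2.1, fun M hM i =>
    residual_mem_tail_of_le hμ hadd hP (hseq N).1 i ((hseq N).2.2 i) hM⟩

end Formal

/-! ### Decay for perturbed stable linear systems. -/

/-- `K t ^ (-ρ)` is eventually a supersolution: once `ρ / t ≤ l / 2`, the choice `K = 2 C / l` makes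
`exp (l t) (K t ^ (-ρ) - V)` nondecreasing. The initial value contributes a multiple of `exp (-l
t)`, eventually at most `t ^ (-ρ)`. -/
theorem eventually_le_of_deriv_le {V V' : ℝ → ℝ} {l C ρ : ℝ} (hl : 0 < l) (hC : 0 ≤ C)
    (hV : ∀ᶠ t in atTop, HasDerivAt V (V' t) t)
    (hV' : ∀ᶠ t in atTop, V' t ≤ -l * V t + C * t ^ (-ρ)) :
    ∃ K : ℝ, 0 ≤ K ∧ ∀ᶠ t in atTop, V t ≤ K * t ^ (-ρ) := by
  set K : ℝ := 2 * C / l with hK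
  have hK0 : 0 ≤ K := by positivity
  obtain ⟨T, hT⟩ := eventually_atTop.1 ((hV.and hV').and
    ((eventually_gt_atTop (0 : ℝ)).and (eventually_ge_atTop (2 * |ρ| / l))))
  let W : ℝ → ℝ := fun t => Real.exp (l * t) * (K * t ^ (-ρ) - V t)
  have hW : ∀ t, T ≤ t → HasDerivAt W (Real.exp (l * t) * l * (K * t ^ (-ρ) - V t) +
      Real.exp (l * t) * (K * (-ρ * t ^ (-ρ - 1)) - V' t)) t := by
    intro t ht
    obtain ⟨⟨h1, h2⟩, h3, h4⟩ := hT t ht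
    have he : HasDerivAt (fun t => Real.exp (l * t)) (Real.exp (l * t) * l) t := by
      simpa using ((hasDerivAt_id t).const_mul l).exp
    exact he.mul (((Real.hasDerivAt_rpow_const (Or.inl h3.ne')).const_mul K).sub h1)
  have hmono : MonotoneOn W (Set.Ici T) := by
    refine monotoneOn_of_deriv_nonneg (convex_Ici T)
      (fun t ht => (hW t ht).continuousAt.continuousWithinAt)
      (fun t ht => (hW t (interior_subset ht)).differentiableAt.differentiableWithinAt)
      fun t ht => ?_
    have ht : T ≤ t := interior_subset ht
    obtain ⟨⟨h1, h2⟩, h3, h4⟩ := hT t ht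
    rw [(hW t ht).deriv]
    have hρ : ρ / t ≤ l / 2 := by
      rw [div_le_iff₀ h3]
      rw [div_le_iff₀ hl] at h4
      linarith [le_abs_self ρ]
    have hp : 0 < t ^ (-ρ) := Real.rpow_pos_of_pos h3 _
    have e1 : t ^ (-ρ - 1) = t ^ (-ρ) / t := by rw [Real.rpow_sub h3, Real.rpow_one]
    have e2 : Real.exp (l * t) * l * (K * t ^ (-ρ) - V t) +
        Real.exp (l * t) * (K * (-ρ * t ^ (-ρ - 1)) - V' t) =
        Real.exp (l * t) * (K * t ^ (-ρ) * (l - ρ / t) - (l * V t + V' t)) := by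
      rw [e1]
      field_simp
      ring
    rw [e2]
    refine mul_nonneg (Real.exp_pos _).le ?_
    have e3 : K * t ^ (-ρ) * (l / 2) ≤ K * t ^ (-ρ) * (l - ρ / t) :=
      mul_le_mul_of_nonneg_left (by linarith) (by positivity)
    have e4 : K * t ^ (-ρ) * (l / 2) = C * t ^ (-ρ) := by
      rw [hK]
      field_simp
    linarith
  have hexp := (isLittleO_exp_neg_mul_rpow_atTop hl (-ρ)).bound one_pos
  refine ⟨K + |W T|, by positivity, ?_⟩
  filter_upwards [hexp, eventually_ge_atTop T] with t h1 ht
  have h3 := (hT t ht).2.1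
  have h2 : W T ≤ W t := hmono (Set.self_mem_Ici) ht ht
  have hp : 0 < t ^ (-ρ) := Real.rpow_pos_of_pos h3 _
  rw [one_mul, Real.norm_of_nonneg (Real.exp_pos _).le, Real.norm_of_nonneg hp.le] at h1
  have h4 : Real.exp (-l * t) * W t = K * t ^ (-ρ) - V t := by
    simp only [W]
    rw [← mul_assoc, ← Real.exp_add]
    simp
  have h5 : Real.exp (-l * t) * W T ≤ Real.exp (-l * t) * W t :=
    mul_le_mul_of_nonneg_left h2 (Real.exp_pos _).le
  have h6 : -(t ^ (-ρ) * |W T|) ≤ Real.exp (-l * t) * W T := by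
    have := neg_abs_le (Real.exp (-l * t) * W T)
    rw [abs_mul, abs_of_pos (Real.exp_pos _)] at this
    have := mul_le_mul_of_nonneg_right h1 (abs_nonneg (W T))
    linarith
  linarith

/-- The columns of `S⁻¹` are eigenvectors, so every diagonal entry is an eigenvalue. -/
theorem DiagPosEigen.exists_diagonalization {n : ℕ} {A : Matrix (Fin n) (Fin n) ℝ} (hA : DiagPosEigen A) :
    ∃ (S : Matrix (Fin n) (Fin n) ℝ) (d : Fin n → ℝ), IsUnit S ∧
      A = S⁻¹ * Matrix.diagonal d * S ∧ ∀ i, 0 < d i := by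
  obtain ⟨S, d, hS, h⟩ := hA.diagonalizable
  have hS' := (Matrix.isUnit_iff_isUnit_det S).1 hS
  refine ⟨S, d, hS, h, fun i => hA.pos_of_eigenvalue _ ?_⟩
  refine Module.End.hasEigenvalue_of_hasEigenvector (x := S⁻¹.mulVec (Pi.single i 1)) ⟨?_, ?_⟩
  · rw [Module.End.mem_eigenspace_iff, Matrix.toLin'_apply, h, Matrix.mulVec_mulVec,
      Matrix.mul_assoc, Matrix.mul_nonsing_inv S hS', Matrix.mul_one, ← Matrix.mulVec_mulVec,
      ← Matrix.mulVec_smul]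
    congr 1
    ext j
    rw [Matrix.mulVec_diagonal]
    by_cases hj : j = i
    · subst hj; simp
    · simp [hj]
  · intro h0
    have := congrArg S.mulVec h0
    rw [Matrix.mulVec_mulVec, Matrix.mul_nonsing_inv S hS', Matrix.one_mulVec,
      Matrix.mulVec_zero] at this
    simpa using congrFun this i

theorem DiagPosEigen.isUnit {n : ℕ} {A : Matrix (Fin n) (Fin n) ℝ} (hA : DiagPosEigen A) :
    IsUnit A := by
  obtain ⟨S, d, hS, rfl, hd⟩ := DiagPosEigen.exists_diagonalization hA
  have hS' := (Matrix.isUnit_iff_isUnit_det S).1 hS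
  refine ((Matrix.isUnit_nonsing_inv_iff.2 hS).mul ?_).mul hS
  rw [Matrix.isUnit_iff_isUnit_det, Matrix.det_diagonal, isUnit_iff_ne_zero]
  exact Finset.prod_ne_zero_iff.2 fun i _ => (hd i).ne'

/-- A decay estimate for perturbations of `z' = -A z`. -/
theorem isBigO_of_perturbation {n : ℕ} {A : Matrix (Fin n) (Fin n) ℝ} (hA : DiagPosEigen A) :
    ∃ ε : ℝ, 0 < ε ∧ ∀ (z g : ℝ → Vec n) (C ρ : ℝ),
      (∀ᶠ t in atTop, HasDerivAt z (-(Matrix.toEuclideanLin A (z t)) + g t) t) →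
      (∀ᶠ t in atTop, ‖g t‖ ≤ ε * ‖z t‖ + C * t ^ (-ρ)) →
      z =O[atTop] fun t : ℝ => t ^ (-ρ) := by
  obtain ⟨S, d, hS, hAS, hd⟩ := DiagPosEigen.exists_diagonalization hA
  have hS' := (Matrix.isUnit_iff_isUnit_det S).1 hS
  obtain ⟨l, hl, hld⟩ : ∃ l : ℝ, 0 < l ∧ ∀ i, l ≤ d i := by
    rcases isEmpty_or_nonempty (Fin n) with h | h
    · exact ⟨1, one_pos, fun i => h.elim i⟩
    · obtain ⟨i, hi⟩ := Finite.exists_min d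
      exact ⟨d i, hd i, hi⟩
  let L : Vec n →L[ℝ] Vec n := (Matrix.toEuclideanLin S).toContinuousLinearMap
  let L' : Vec n →L[ℝ] Vec n := (Matrix.toEuclideanLin S⁻¹).toContinuousLinearMap
  have hL' : ∀ x, L' (L x) = x := fun x => by
    ext i
    simp [L, L', Matrix.toLpLin_apply, Matrix.mulVec_mulVec, Matrix.nonsing_inv_mul S hS']
  have hLA : ∀ x, L (Matrix.toEuclideanLin A x) =
      Matrix.toEuclideanLin (Matrix.diagonal d) (L x) := fun x => by
    ext i
    simp [L, hAS, Matrix.toLpLin_apply, Matrix.mulVec_mulVec, ← Matrix.mul_assoc,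
      Matrix.mul_nonsing_inv S hS']
  have hinner : ∀ w : Vec n, l * ‖w‖ ^ 2 ≤
      inner ℝ w (Matrix.toEuclideanLin (Matrix.diagonal d) w) := fun w => by
    rw [EuclideanSpace.norm_sq_eq, PiLp.inner_apply, Finset.mul_sum]
    refine Finset.sum_le_sum fun i _ => ?_
    simp only [Matrix.toLpLin_apply, Matrix.mulVec_diagonal, Real.norm_eq_abs, sq_abs]
    have h := mul_le_mul_of_nonneg_right (hld i) (sq_nonneg (w i))
    simp only [inner, RCLike.re_to_real, star_trivial] at h ⊢
    linarith
  set a := ‖L‖ with ha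
  set b := ‖L'‖ with hb
  have ha0 : 0 ≤ a := norm_nonneg _
  have hb0 : 0 ≤ b := norm_nonneg _
  -- Small enough that in diagonal coordinates the `ε ‖z‖` part costs at most a quarter of the
  -- damping `l`; the `+ 1` avoids division by zero.
  refine ⟨l / (4 * (a * b + 1)), by positivity, fun z g C ρ hz hg => ?_⟩
  set ε := l / (4 * (a * b + 1)) with hε
  have hε' : a * (ε * b) ≤ l / 4 := by
    have : a * (ε * b) = l / 4 * (a * b / (a * b + 1)) := by
      rw [hε]
      field_simp
    rw [this]
    exact mul_le_of_le_one_right (by positivity)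
      (by rw [div_le_one (by positivity)]; linarith)
  have hV : ∀ᶠ t in atTop, HasDerivAt (fun t => ‖L (z t)‖ ^ 2)
      (2 * inner ℝ (L (z t)) (L (-(Matrix.toEuclideanLin A (z t)) + g t))) t := by
    filter_upwards [hz] with t ht
    exact (L.hasFDerivAt.comp_hasDerivAt t ht).norm_sq
  -- Energy estimate: the damping gives `-2 l ‖w‖ ^ 2`, the `ε` part costs `l / 2`, and Young's
  -- inequality for the forcing costs another `l / 2`, leaving `-l`.
  have hV' : ∀ᶠ t in atTop, 2 * inner ℝ (L (z t)) (L (-(Matrix.toEuclideanLin A (z t)) + g t)) ≤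
      -l * ‖L (z t)‖ ^ 2 + 2 / l * (a * C) ^ 2 * t ^ (-(2 * ρ)) := by
    filter_upwards [hg, eventually_gt_atTop 0] with t ht h0
    rw [map_add, map_neg, hLA, inner_add_right, inner_neg_right]
    set w := L (z t) with hw
    have h1 := hinner w
    have h2 : inner ℝ w (L (g t)) ≤ ‖w‖ * (a * ‖g t‖) :=
      (real_inner_le_norm _ _).trans
        (mul_le_mul_of_nonneg_left (L.le_opNorm _) (norm_nonneg _))
    have h3 : ‖z t‖ ≤ b * ‖w‖ := by
      have := L'.le_opNorm (L (z t))
      rwa [hL'] at this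
    have hε0 : 0 ≤ ε := by positivity
    have h4 : a * ‖g t‖ ≤ l / 4 * ‖w‖ + a * (C * t ^ (-ρ)) := by
      calc a * ‖g t‖ ≤ a * (ε * (b * ‖w‖) + C * t ^ (-ρ)) := by gcongr; exact ht.trans (by gcongr)
        _ = a * (ε * b) * ‖w‖ + a * (C * t ^ (-ρ)) := by ring
        _ ≤ _ := by gcongr
    have h5 : ‖w‖ * (a * ‖g t‖) ≤ ‖w‖ * (l / 4 * ‖w‖ + a * (C * t ^ (-ρ))) :=
      mul_le_mul_of_nonneg_left h4 (norm_nonneg _)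
    have h6 : 2 * (‖w‖ * (a * (C * t ^ (-ρ)))) ≤
        l / 2 * ‖w‖ ^ 2 + 2 / l * (a * C) ^ 2 * t ^ (-(2 * ρ)) := by
      rw [show -(2 * ρ) = -ρ + -ρ by ring, Real.rpow_add h0]
      have := sq_nonneg (l * ‖w‖ - 2 * (a * (C * t ^ (-ρ))))
      have e : l / 2 * ‖w‖ ^ 2 + 2 / l * (a * C) ^ 2 * (t ^ (-ρ) * t ^ (-ρ)) -
          2 * (‖w‖ * (a * (C * t ^ (-ρ)))) =
          (l * ‖w‖ - 2 * (a * (C * t ^ (-ρ)))) ^ 2 / (2 * l) := by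
        field_simp
        ring
      have : 0 ≤ (l * ‖w‖ - 2 * (a * (C * t ^ (-ρ)))) ^ 2 / (2 * l) := by positivity
      linarith
    nlinarith [mul_nonneg hl.le (sq_nonneg ‖w‖)]
  obtain ⟨K, hK0, hK⟩ := eventually_le_of_deriv_le hl (by positivity) hV hV'
  have hL2 : (fun t => L (z t)) =O[atTop] fun t : ℝ => t ^ (-ρ) := by
    refine IsBigO.of_bound (√K) ?_
    filter_upwards [hK, eventually_gt_atTop 0] with t ht h0
    have hp : 0 < t ^ (-ρ) := Real.rpow_pos_of_pos h0 _
    rw [Real.norm_of_nonneg hp.le]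
    refine (Real.le_sqrt (norm_nonneg _) (by positivity)).2 ht |>.trans ?_
    rw [Real.sqrt_mul hK0, show -(2 * ρ) = -ρ + -ρ by ring, Real.rpow_add h0,
      Real.sqrt_mul_self hp.le]
  have := (L'.isBigO_comp (fun t => L (z t)) atTop).trans hL2
  simpa only [hL'] using this

/-! ### Decay rates and orders of vanishing as submodules. -/

section Decay

/-- The functions that are `O(t ^ (-ν))` as `t → ∞`. -/
def decaying (ν : ℝ) : Submodule ℝ (ℝ → ℝ) where
  carrier := {g | g =O[atTop] fun t : ℝ => t ^ (-ν)}
  add_mem' := fun h1 h2 => IsBigO.add h1 h2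
  zero_mem' := isBigO_zero _ _
  smul_mem' := fun c _ h => IsBigO.const_smul_left h c

theorem isBigO_rpow_neg {ν ν' : ℝ} (h : ν ≤ ν') :
    (fun t : ℝ => t ^ (-ν')) =O[atTop] fun t : ℝ => t ^ (-ν) := by
  refine IsBigO.of_bound 1 ?_
  filter_upwards [eventually_ge_atTop 1] with t ht
  have h0 : 0 ≤ t := zero_le_one.trans ht
  rw [Real.norm_of_nonneg (Real.rpow_nonneg h0 _), Real.norm_of_nonneg (Real.rpow_nonneg h0 _),
    one_mul]
  exact Real.rpow_le_rpow_of_exponent_le ht (by linarith)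

theorem decaying_anti {ν ν' : ℝ} (h : ν ≤ ν') : decaying ν' ≤ decaying ν :=
  fun _ hg => IsBigO.trans hg (isBigO_rpow_neg h)

theorem mul_mem_decaying {ν ν' : ℝ} {g h : ℝ → ℝ} (hg : g ∈ decaying ν) (hh : h ∈ decaying ν') :
    g * h ∈ decaying (ν + ν') := by
  refine (IsBigO.mul hg hh).trans_eventuallyEq ?_
  filter_upwards [eventually_gt_atTop 0] with t ht
  rw [← Real.rpow_add ht]
  congr 1
  ring

theorem isBigO_vec_iff {α : Type*} {l : Filter α} {n : ℕ} {h : α → Vec n} {g : α → ℝ} :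
    h =O[l] g ↔ ∀ i, (fun t => h t i) =O[l] g := by
  rw [← isBigO_pi]
  refine ⟨fun H => ?_, fun H => ?_⟩
  · exact ((EuclideanSpace.equiv (Fin n) ℝ).isBigO_comp h l).trans H
  · exact ((EuclideanSpace.equiv (Fin n) ℝ).isBigO_comp_rev h l).trans H

theorem isLittleO_vec_iff {α : Type*} {l : Filter α} {n : ℕ} {h : α → Vec n} {g : α → ℝ} :
    h =o[l] g ↔ ∀ i, (fun t => h t i) =o[l] g := by
  rw [← isLittleO_pi]
  refine ⟨fun H => ?_, fun H => ?_⟩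
  · exact ((EuclideanSpace.equiv (Fin n) ℝ).isBigO_comp h l).trans_isLittleO H
  · exact ((EuclideanSpace.equiv (Fin n) ℝ).isBigO_comp_rev h l).trans_isLittleO H

end Decay

/-- A homogeneous polynomial of degree at least two is `o(|y|)` as `y → 0`. -/
theorem isLittleO_eval {n m : ℕ} (hm : 2 ≤ m) {P : MvPolynomial (Fin n) ℝ}
    (hP : P.IsHomogeneous m) :
    (fun y : Vec n => MvPolynomial.eval (fun j => y j) P) =o[𝓝 0] fun y => ‖y‖ := by
  let I : Submodule ℝ (Vec n → ℝ) :=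
    { carrier := {g | g =O[𝓝 0] fun y : Vec n => ‖y‖}
      add_mem' := fun h1 h2 => IsBigO.add h1 h2
      zero_mem' := isBigO_zero _ _
      smul_mem' := fun c _ h => IsBigO.const_smul_left h c }
  let J : Submodule ℝ (Vec n → ℝ) :=
    { carrier := {g | g =o[𝓝 0] fun y : Vec n => ‖y‖}
      add_mem' := fun h1 h2 => IsLittleO.add h1 h2
      zero_mem' := isLittleO_zero _ _
      smul_mem' := fun c _ h => IsLittleO.const_smul_left h c }
  let u : Fin n → Vec n → ℝ := fun i y => y i
  have hu : ∀ i, u i ∈ I := fun i => isBigO_vec_iff.1 (isBigO_norm_right.2 (isBigO_refl id _)) i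
  have hIJ : ∀ a ∈ I, ∀ b ∈ I, a * b ∈ J := by
    intro a ha b hb
    have h1 : a =o[𝓝 0] fun _ : Vec n => (1 : ℝ) := by
      refine IsBigO.trans_isLittleO ha ?_
      rw [isLittleO_one_iff]
      simpa using (continuous_norm (E := Vec n)).tendsto 0
    have h2 := IsLittleO.mul_isBigO h1 hb
    simp only [one_mul] at h2
    exact h2
  have h0 : MvPolynomial.aeval (0 : Fin n → Vec n → ℝ) P = 0 := by
    have := aeval_mem (I := ⊤) (W := fun _ => (⊥ : Submodule ℝ (Vec n → ℝ)))
      (u := (0 : Fin n → Vec n → ℝ)) ?_ (fun _ => trivial) (fun _ => zero_mem _)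
      (by omega) hP
    · simpa using this
    · intro m _ a _ b hb
      simp only [Submodule.mem_bot] at hb ⊢
      rw [hb, mul_zero]
  -- Comparison with the zero point: a product of two `O(‖y‖)` functions is `o(‖y‖)`.
  have := aeval_sub_mem (I := I) (J := I) (J' := J) (u := u) (v := 0)
    (fun a ha b hb => IsLittleO.isBigO (hIJ a ha b hb)) hIJ (fun _ h => IsLittleO.isBigO h) hu
    (fun _ => zero_mem _) (fun i => by simpa using hu i) hm hP
  rw [h0, sub_zero] at this
  have e : MvPolynomial.aeval u P = fun y : Vec n => MvPolynomial.eval (fun j => y j) P :=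
    funext fun y => aeval_apply u P y
  rw [e] at this
  exact this

/-! ### Translation between layers and explicit log sums. -/

section LogTerms

variable {n : ℕ}

/-- `h(t) = t ^ (-a) * ∑_j (log t) ^ (-γ j) * q_j (log (log t))` for `t > 1`, with polynomials
`q_j` and `γ j ≥ 0`. -/
def IsLogTerm (a : ℝ) (h : ℝ → Vec n) : Prop :=
  ∃ (J : ℕ) (q : ℕ → ℝ → Vec n) (γ : ℕ → ℝ), 1 ≤ J ∧ (∀ j < J, IsPoly (q j) ∧ 0 ≤ γ j) ∧
    ∀ t : ℝ, 1 < t → h t = t ^ (-a) •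
      ∑ j ∈ Finset.range J, (Real.log t ^ (-γ j)) • q j (Real.log (Real.log t))

/-- The exponents need not be distinct, so the two lists of summands are simply concatenated. -/
theorem IsLogTerm.add {a : ℝ} {h h' : ℝ → Vec n} (hh : IsLogTerm a h) (hh' : IsLogTerm a h') :
    IsLogTerm a (fun t => h t + h' t) := by
  obtain ⟨J, q, γ, hJ, hq, e⟩ := hh
  obtain ⟨J', q', γ', hJ', hq', e'⟩ := hh'
  refine ⟨J + J', fun j => if j < J then q j else q' (j - J),
    fun j => if j < J then γ j else γ' (j - J), by omega, fun j hj => ?_, fun t ht => ?_⟩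
  · by_cases h : j < J
    · simpa [h] using hq j h
    · simpa [h] using hq' (j - J) (by omega)
  · beta_reduce
    rw [e t ht, e' t ht, ← smul_add, Finset.sum_range_add]
    congr 2
    · refine Finset.sum_congr rfl fun j hj => ?_
      simp [Finset.mem_range.1 hj]
    · refine Finset.sum_congr rfl fun j hj => ?_
      simp

theorem IsLogTerm.zero (a : ℝ) : IsLogTerm a (fun _ => (0 : Vec n)) :=
  ⟨1, fun _ _ => 0, fun _ => 0, le_rfl, fun _ _ => ⟨⟨0, 0, by simp⟩, le_rfl⟩, by simp⟩

theorem IsLogTerm.sum {a : ℝ} {ι : Type*} (s : Finset ι) {h : ι → ℝ → Vec n}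
    (hh : ∀ i, IsLogTerm a (h i)) : IsLogTerm a (fun t => ∑ i ∈ s, h i t) := by
  classical
  induction s using Finset.induction_on with
  | empty => simpa using IsLogTerm.zero a
  | insert i s hi ih => simpa [Finset.sum_insert hi] using (hh i).add ih

/-- The vector is quantified inside the induction so that a scalar factor of `g` can be moved onto
it. -/
theorem isLogTerm_smul_of_mem_layer {μ : ℕ → ℝ} {k : ℕ} {g : ℝ → ℝ} (hg : g ∈ layer μ k) :
    ∀ v : Vec n, IsLogTerm (μ k) (fun t => g t • v) := by
  induction hg using Submodule.span_induction with
  | mem g hg =>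
    obtain ⟨b, j, hb, rfl⟩ := hg
    refine fun v => ⟨1, fun _ s => s ^ j • v, fun _ => b, le_rfl, fun _ _ =>
      ⟨⟨j, fun i => if i = j then v else 0, fun t => ?_⟩, hb⟩, fun t ht => ?_⟩
    · simp
    · beta_reduce
      rw [logMono_eq _ _ _ ht]
      simp [smul_smul]
  | zero => exact fun v => by simpa using IsLogTerm.zero (μ k)
  | add g h _ _ hg hh => exact fun v => by simpa [add_smul] using (hg v).add (hh v)
  | smul c g _ hg =>
    refine fun v => ?_
    have := hg (c • v)
    simpa [smul_smul, mul_comm] using this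

theorem isLogTerm_of_mem_layer {μ : ℕ → ℝ} {k : ℕ} {g : Fin n → ℝ → ℝ}
    (hg : ∀ i, g i ∈ layer μ k) : IsLogTerm (μ k) (fun t => WithLp.toLp 2 fun i => g i t) := by
  have := IsLogTerm.sum Finset.univ
    (fun i => isLogTerm_smul_of_mem_layer (hg i) (EuclideanSpace.single i (1 : ℝ)))
  convert this using 2 with t
  ext i
  simp [Pi.single_apply]

theorem exists_mem_layer (μ : ℕ → ℝ) (k : ℕ) {J : ℕ} {p : ℕ → ℝ → Vec n} {β : ℕ → ℝ}
    (hβ : ∀ j < J, 0 ≤ β j) (hp : ∀ j < J, IsPoly (p j)) (i : Fin n) :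
    ∃ F ∈ layer μ k, ∀ t : ℝ, 1 < t → F t = (t ^ (-μ k) •
      ∑ j ∈ Finset.range J, (Real.log t ^ (-β j)) • p j (Real.log (Real.log t))) i := by
  induction J with
  | zero => exact ⟨0, zero_mem _, by simp⟩
  | succ J ih =>
    obtain ⟨F, hF, e⟩ := ih (fun j hj => hβ j (by omega)) (fun j hj => hp j (by omega))
    obtain ⟨d, a, ha⟩ := hp J (by omega)
    refine ⟨F + ∑ l ∈ Finset.range (d + 1), a l i • logMono (μ k) (β J) l, add_mem hF
      (Submodule.sum_mem _ fun l _ => Submodule.smul_mem _ _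
        (logMono_mem_layer k (hβ J (by omega)) l)), fun t ht => ?_⟩
    rw [Finset.sum_range_succ _ J, smul_add, PiLp.add_apply, Pi.add_apply, e t ht, ha]
    congr 1
    simp only [Finset.sum_apply, Pi.smul_apply, logMono_eq _ _ _ ht, smul_eq_mul, PiLp.smul_apply,
      WithLp.ofLp_sum, WithLp.ofLp_smul, Finset.mul_sum]
    refine Finset.sum_congr rfl fun l _ => ?_
    ring

end LogTerms

/-! ### Comparison of the true solution with approximate ones. -/

section Solutions

variable {n : ℕ} {A : Matrix (Fin n) (Fin n) ℝ} {G : Vec n → Vec n} {f y : ℝ → Vec n}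

theorem AdmissibleNonlinearity.isLittleO (hG : AdmissibleNonlinearity G) :
    G =o[𝓝 0] fun y => ‖y‖ := by
  obtain ⟨Gm, hGm, hexp⟩ := hG.expansion
  obtain ⟨δ, hδ, h⟩ := hexp 2 le_rfl
  simp only [Finset.Icc_self, Finset.sum_singleton, Nat.cast_ofNat] at h
  obtain ⟨P, hP, e⟩ := hGm 2 le_rfl
  have h2 : Gm 2 =o[𝓝 0] fun y => ‖y‖ := by
    rw [isLittleO_vec_iff]
    intro i
    simp only [e]
    exact isLittleO_eval le_rfl (hP i)
  have h3 : (fun y : Vec n => ‖y‖ ^ ((2 : ℝ) + δ)) =o[𝓝 0] fun y => ‖y‖ := by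
    have h4 : (fun y : Vec n => ‖y‖ ^ ((1 : ℝ) + δ)) =o[𝓝 0] fun _ : Vec n => (1 : ℝ) := by
      rw [isLittleO_one_iff]
      have := ((continuous_norm (E := Vec n)).tendsto 0).rpow_const (p := 1 + δ)
        (Or.inr (by linarith))
      rwa [norm_zero, Real.zero_rpow (by linarith)] at this
    have h5 := (isBigO_refl (fun y : Vec n => ‖y‖) (𝓝 0)).mul_isLittleO h4
    simp only [mul_one] at h5
    refine h5.congr_left fun y => ?_
    rw [show (2 : ℝ) + δ = 1 + (1 + δ) by ring,
      Real.rpow_add_of_nonneg (norm_nonneg y) zero_le_one (by linarith : 0 ≤ 1 + δ), Real.rpow_one]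
  have := (h.trans_isLittleO h3).add h2
  simpa using this

/-- As `y → 0` and `G(y) = o(‖y‖)`, the nonlinearity is eventually within the tolerance `ε`, with no
prior rate for `y`. This supplies the first rate for the bootstrap. -/
theorem IsDecayingSolution.isBigO (hA : DiagPosEigen A) (hG : AdmissibleNonlinearity G)
    (hy : IsDecayingSolution A G f y) {c : ℝ} (hf : f =O[atTop] fun t : ℝ => t ^ (-c)) :
    y =O[atTop] fun t : ℝ => t ^ (-c) := by
  obtain ⟨ε, hε, H⟩ := isBigO_of_perturbation hA
  obtain ⟨C, hC⟩ := hf.bound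
  obtain ⟨T, -, -, hT⟩ := hy.solution
  refine H y (fun t => G (y t) + f t) C c ?_ ?_
  · filter_upwards [eventually_gt_atTop T] with t ht
    simpa only [add_assoc] using hT t ht
  · filter_upwards [hy.decay.eventually (hG.isLittleO.bound hε), hC, eventually_gt_atTop 0]
      with t h1 h2 h0
    rw [norm_norm] at h1
    rw [Real.norm_of_nonneg (Real.rpow_nonneg h0.le _)] at h2
    exact (norm_add_le _ _).trans (add_le_add h1 h2)

theorem hasDerivAt_toLp {Y Y' : Fin n → ℝ → ℝ} {t : ℝ}
    (h : ∀ i, HasDerivAt (Y i) (Y' i t) t) :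
    HasDerivAt (fun t => (WithLp.toLp 2 fun i => Y i t : Vec n))
      (WithLp.toLp 2 fun i => Y' i t) t := by
  have h1 : HasDerivAt (fun t i => Y i t) (fun i => Y' i t) t := hasDerivAt_pi.2 h
  exact ((EuclideanSpace.equiv (Fin n) ℝ).symm.toContinuousLinearMap.hasFDerivAt).comp_hasDerivAt
    t h1

/-- An approximate solution, with a residual of order `ρ`, agrees with the decaying solution up to
order `ρ`. -/
theorem IsDecayingSolution.isBigO_sub (hA : DiagPosEigen A) (hy : IsDecayingSolution A G f y)
    {Gm : ℕ → Vec n → Vec n} {P : ℕ → Fin n → MvPolynomial (Fin n) ℝ}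
    (hP : ∀ m, 2 ≤ m → ∀ i, (P m i).IsHomogeneous m)
    (hPG : ∀ m, 2 ≤ m → ∀ y i, Gm m y i = MvPolynomial.eval (fun j => y j) (P m i))
    {c ρ δ : ℝ} (hc : 0 < c) (hcρ : c ≤ ρ) (hδ : 0 < δ) {M N : ℕ} (hM : ρ ≤ c * M)
    (hGM : (fun y : Vec n => G y - ∑ m ∈ Finset.Icc 2 M, Gm m y)
        =O[𝓝 0] (fun y : Vec n => ‖y‖ ^ ((M : ℝ) + δ)))
    (hyc : y =O[atTop] fun t : ℝ => t ^ (-c))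
    {F : ℕ → Fin n → ℝ → ℝ} {Y Y' : Fin n → ℝ → ℝ} (hYc : ∀ i, Y i ∈ decaying c)
    (hYd : ∀ i, ∀ t : ℝ, 1 < t → HasDerivAt (Y i) (Y' i t) t)
    (hres : ∀ i, residual A P F M N Y Y' i ∈ decaying ρ)
    (hF : ∀ i, (fun t => f t i) - ∑ k ∈ Finset.range N, F k i ∈ decaying ρ) :
    (fun t => y t - WithLp.toLp 2 fun i => Y i t) =O[atTop] fun t : ℝ => t ^ (-ρ) := by
  let yc : Fin n → ℝ → ℝ := fun i t => y t i
  have hycc : ∀ i, yc i ∈ decaying c := fun i => isBigO_vec_iff.1 hyc i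
  have hGr : (fun t => G (y t) - ∑ m ∈ Finset.Icc 2 M, Gm m (y t)) =O[atTop]
      fun t : ℝ => t ^ (-ρ) := by
    refine (hGM.comp_tendsto hy.decay).trans ?_
    have h1 : (fun t => ‖y t‖ ^ ((M : ℝ) + δ)) =O[atTop]
        fun t : ℝ => (t ^ (-c)) ^ ((M : ℝ) + δ) := by
      refine IsBigO.rpow (by positivity) ?_ hyc.norm_left
      filter_upwards [eventually_gt_atTop 0] with t ht using Real.rpow_nonneg ht.le _
    have h2 : (fun t : ℝ => (t ^ (-c)) ^ ((M : ℝ) + δ)) =ᶠ[atTop]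
        fun t : ℝ => t ^ (-(c * (M + δ))) := by
      filter_upwards [eventually_gt_atTop 0] with t ht
      rw [← Real.rpow_mul ht.le]
      congr 1
      ring
    exact (h1.trans_eventuallyEq h2).trans
      (isBigO_rpow_neg (hM.trans (mul_le_mul_of_nonneg_left (by linarith) hc.le)))
  obtain ⟨ε, hε, H⟩ := isBigO_of_perturbation hA
  obtain ⟨T, -, -, hT⟩ := hy.solution
  set z : ℝ → Vec n := fun t => y t - WithLp.toLp 2 fun i => Y i t with hz
  -- Everything in the equation for `z` apart from `-A z`.
  let g : ℝ → Vec n := fun t => G (y t) + f t - (WithLp.toLp 2 fun i => Y' i t) -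
    Matrix.toEuclideanLin A (WithLp.toLp 2 fun i => Y i t)
  have hzd : ∀ᶠ t in atTop, HasDerivAt z (-(Matrix.toEuclideanLin A (z t)) + g t) t := by
    filter_upwards [eventually_gt_atTop T, eventually_gt_atTop 1] with t h1 h2
    refine ((hT t h1).sub (hasDerivAt_toLp fun i => hYd i t h2)).congr_deriv ?_
    simp only [z, g, map_sub]
    abel
  have hg : ∀ i, (fun t => g t i) = (fun t => (G (y t) - ∑ m ∈ Finset.Icc 2 M, Gm m (y t)) i) +
      ∑ m ∈ Finset.Icc 2 M, (MvPolynomial.aeval yc (P m i) - MvPolynomial.aeval Y (P m i)) +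
      residual A P F M N Y Y' i + ((fun t => f t i) - ∑ k ∈ Finset.range N, F k i) := by
    intro i
    have e : ∀ t, ∑ m ∈ Finset.Icc 2 M, Gm m (y t) i =
        ∑ m ∈ Finset.Icc 2 M, MvPolynomial.aeval yc (P m i) t := fun t =>
      Finset.sum_congr rfl fun m hm => by
        rw [hPG m (Finset.mem_Icc.1 hm).1, aeval_apply]
    ext t
    simp only [g, residual, Pi.add_apply, Pi.sub_apply, Pi.neg_apply, Finset.sum_apply,
      PiLp.add_apply, PiLp.sub_apply, WithLp.ofLp_sum, Pi.smul_apply, smul_eq_mul, e,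
      Finset.sum_sub_distrib, Matrix.toLpLin_apply, Matrix.mulVec, dotProduct]
    ring
  -- Bootstrap: if `z` has rate `ν`, the polynomial differences have rate `c + ν` and the rest of
  -- `g` has rate `ρ`, so `z` gains `c` per round until it reaches `ρ`.
  have key : ∀ k : ℕ, z =O[atTop] fun t : ℝ => t ^ (-min (c * (k + 1)) ρ) := by
    intro k
    induction k with
    | zero =>
      simp only [Nat.cast_zero, zero_add, mul_one, min_eq_left hcρ]
      refine isBigO_vec_iff.2 fun i => ?_
      exact sub_mem (hycc i) (hYc i)
    | succ k ih =>
      set ν := min (c * (k + 1)) ρ with hν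
      have hcν : c ≤ ν := le_min (by nlinarith [(Nat.cast_nonneg k : (0 : ℝ) ≤ k)]) hcρ
      set ν' := min (c * ((k + 1 : ℕ) + 1)) ρ with hν'
      have h1 : ν' ≤ ρ := min_le_right _ _
      have h2 : ν' ≤ c + ν := by
        rcases min_cases (c * ((k : ℝ) + 1)) ρ with h | h
        · rw [hν, h.1]
          refine (min_le_left _ _).trans (le_of_eq ?_)
          push_cast
          ring
        · rw [hν, h.1]
          linarith
      have hgi : g =O[atTop] fun t : ℝ => t ^ (-ν') := by
        refine isBigO_vec_iff.2 fun i => ?_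
        rw [hg i]
        change _ ∈ decaying ν'
        refine add_mem (add_mem (add_mem (decaying_anti h1 (isBigO_vec_iff.1 hGr i))
          (Submodule.sum_mem _ fun m hm => decaying_anti h2 ?_)) (decaying_anti h1 (hres i)))
          (decaying_anti h1 (hF i))
        have hm := (Finset.mem_Icc.1 hm).1
        refine aeval_sub_mem (I := decaying c) (J := decaying ν) ?_ ?_
          (decaying_anti (by linarith)) hycc hYc (fun i => ?_) hm (hP m hm i)
        · exact fun a ha b hb => decaying_anti (by linarith) (mul_mem_decaying ha hb)
        · exact fun a ha b hb => mul_mem_decaying ha hb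
        · exact isBigO_vec_iff.1 ih i
      obtain ⟨C, hC⟩ := hgi.bound
      -- The smallness term `ε ‖z‖` is not needed here; it is added as a nonnegative quantity.
      refine H z g C ν' hzd ?_
      filter_upwards [hC, eventually_gt_atTop 0] with t h3 h0
      rw [Real.norm_of_nonneg (Real.rpow_nonneg h0.le _)] at h3
      have := mul_nonneg hε.le (norm_nonneg (z t))
      linarith
  obtain ⟨k, hk⟩ := exists_nat_gt (ρ / c)
  have hk' : ρ ≤ c * (k + 1) := by
    rw [div_lt_iff₀ hc] at hk
    linarith
  have := key k
  rwa [min_eq_right hk'] at this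

end Solutions

end DecayODE
end

/-! ### Assembly of the main theorem. -/

theorem mainTheorem6 (n : ℕ) (A : Matrix (Fin n) (Fin n) ℝ)
    (hA : DecayODE.DiagPosEigen A)
    (G : DecayODE.Vec n → DecayODE.Vec n) (hG : DecayODE.AdmissibleNonlinearity G)
    (f : ℝ → DecayODE.Vec n) (hf : DecayODE.EventuallyContinuous f)
    (μ : ℕ → ℝ) (hμ : DecayODE.IsExponentSeq μ)
    (hμ_add : DecayODE.PreservesAddition (Set.range μ))
    (hμ_unit : DecayODE.PreservesUnitIncrement (Set.range μ))
    (r : ℕ → ℕ) (hr : ∀ k, 1 ≤ r k)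
    (β : ℕ → ℕ → ℝ) (hβ : ∀ k, ∀ j < r k, 0 ≤ β k j)
    (p : ℕ → ℕ → ℝ → DecayODE.Vec n) (hp : ∀ k, ∀ j < r k, DecayODE.IsPoly (p k j))
    (hf_exp : DecayODE.HasPowerLogLogLogExpansion f μ r p β)
    (y : ℝ → DecayODE.Vec n) (hy : DecayODE.IsDecayingSolution A G f y) :
    ∃ (J : ℕ → ℕ) (q : ℕ → ℕ → ℝ → DecayODE.Vec n) (γ : ℕ → ℕ → ℝ),
      (∀ k, 1 ≤ J k) ∧
      (∀ k, ∀ j < J k, DecayODE.IsPoly (q k j) ∧ 0 ≤ γ k j) ∧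
      DecayODE.HasPowerLogLogLogExpansion y μ J q γ := by
  open DecayODE in
  choose F hFl hFe using fun k i => exists_mem_layer μ k (hβ k) (hp k) i
  obtain ⟨Gm, hGm, hexp⟩ := hG.expansion
  choose! P hP hPG using hGm
  obtain ⟨a, ha, hform⟩ := exists_formal_solution hμ hμ_add hμ_unit hA.isUnit hP hFl
  choose J q γ hJ hq he using fun k => isLogTerm_of_mem_layer (ha k)
  refine ⟨J, q, γ, hJ, hq, (hasPowerLogLogLogExpansion_iff y μ J q γ hμ
    fun k j hj => (hq k j hj).1).2 fun N => ?_⟩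
  have hf' := (hasPowerLogLogLogExpansion_iff f μ r p β hμ hp).1 hf_exp
  -- the remainder of the expansion of `f`
  have hfF : ∀ N ρ, ρ < μ N → ∀ i,
      (fun t => f t i) - ∑ k ∈ Finset.range N, F k i ∈ decaying ρ := by
    intro N ρ hρ i
    obtain ⟨ν, hν, h⟩ := hf' N
    have h1 : (fun t => f t i) - ∑ k ∈ Finset.range (N + 1), F k i ∈ decaying ρ := by
      refine decaying_anti (hρ.trans hν).le ?_
      refine IsBigO.congr' (isBigO_vec_iff.1 h i) ?_ EventuallyEq.rfl
      filter_upwards [eventually_gt_atTop 1] with t ht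
      simp only [PiLp.sub_apply, WithLp.ofLp_sum, Finset.sum_apply, Pi.sub_apply, hFe _ _ t ht]
    -- Since `ρ < μ N`, the last term of the expansion can be moved into the error.
    have h2 : F N i ∈ decaying ρ := isBigO_of_mem_tail hμ hρ (layer_le_tail le_rfl (hFl N i))
    have h3 := add_mem h1 h2
    rw [Finset.sum_range_succ] at h3
    convert h3 using 1
    abel
  -- Any positive rate strictly below `μ 0` would do; `μ 0` itself can fail because of the `log (log
  -- t)` factors.
  set c := μ 0 / 2 with hc
  have hμ0 := hμ.pos 0
  have hc0 : 0 < c := by positivity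
  have hyc : y =O[atTop] fun t : ℝ => t ^ (-c) := by
    refine hy.isBigO hA hG (isBigO_vec_iff.2 fun i => ?_)
    have := hfF 0 c (by linarith) i
    rw [Finset.sum_range_zero, sub_zero] at this
    exact this
  -- Above `μ N`, as the expansion demands, and below `μ (N + 1)`, so that elements of the next tail
  -- are `O(t ^ (-ρ))`.
  obtain ⟨ρ, hρ, hρ'⟩ := exists_between (hμ.strictMono (Nat.lt_succ_self N))
  refine ⟨ρ, hρ, ?_⟩
  obtain ⟨Y', hYd, hres⟩ := hform (N + 1)
  -- The truncation degree must make `‖y‖ ^ M` of order `t ^ (-ρ)` and be at least `N + 2` for the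
  -- residual bound.
  obtain ⟨M, hM⟩ := exists_nat_gt (max (ρ / c) (N + 2 : ℕ))
  have hM1 : ρ ≤ c * M := by
    have := (le_max_left _ _).trans_lt hM
    rw [div_lt_iff₀ hc0] at this
    linarith
  have hM2 : N + 2 < M := by exact_mod_cast (le_max_right _ _).trans_lt hM
  obtain ⟨δ, hδ, hGM⟩ := hexp M (by omega)
  have hμN : μ 0 ≤ μ N := hμ.strictMono.monotone (Nat.zero_le N)
  have := hy.isBigO_sub hA hP hPG hc0 (by linarith) hδ hM1 hGM hyc
    (fun i => isBigO_of_mem_tail hμ (N := 0) (by linarith)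
      (Submodule.sum_mem _ fun k _ => layer_le_tail (Nat.zero_le k) (ha k i))) hYd
    (fun i => isBigO_of_mem_tail hμ hρ' (hres M (by omega) i))
    (fun i => hfF (N + 1) ρ hρ' i)
  refine this.congr' ?_ EventuallyEq.rfl
  filter_upwards [eventually_gt_atTop 1] with t ht
  simp only [← he _ t ht]
  congr 1
  ext i
  simp [Finset.sum_apply]
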